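/- Let $\mathbb{F}$ be an arbitrary field, let $V$ be an infinite-dimensional vector space over $\mathbb{F}$ (of any infinite dimension), and let $u$ be an endomorphism of $V$, that is, an $\mathbb{F}$-linear map from $V$ to $V$. Then: 1. there are endomorphisms $a_1,a_2,a_3,a_4$ of $V$ with $a_k^2=0$ for every $k\in\{1,2,3,4\}$ and $u=a_1+a_2+a_3+a_4$; 2. there are endomorphisms $p_1,p_2,p_3,p_4$ of $V$ with $p_k^2=p_k$ for every $k\in\{1,2,3,4\}$ and $u=p_1+p_2+p_3+p_4$. -/

import Mathlib

open Module

/-! ### Splitting shifts along an alternating colouring. -/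

section Colouring

variable {F V ι : Type*} [Field F] [AddCommGroup V] [Module F V]

/-! Choose a well-ordered basis `e` and an increasing `s` with `i < s i` such that `u (e i)`
involves only vectors below `e (s i)` (`exists_basis_dominating_shift`). If `S` is the shift `e i ↦
e (s i)`, then `u + S` has leading term `e (s i)`, so it is itself a shift in another basis
(`exists_basis_shift`). A multiple of a shift is a sum of two square-zero maps, and `1` plus such a
multiple is a sum of two idempotents. Conclude with `u = -S + (u + S)` and `u = (1 - S) + (1 + (u +
S - 2))`. -/

theorem exists_two_colouring [LinearOrder ι] [WellFoundedLT ι] {s : ι → ι}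
    (hs : StrictMono s) (hlt : ∀ i, i < s i) : ∃ c : ι → Bool, ∀ i, c (s i) = !c i := by
  classical
  let step : (i : ι) → ((j : ι) → j < i → Bool) → Bool := fun i IH =>
    if h : ∃ j, s j = i then !IH h.choose ((hlt _).trans_eq h.choose_spec) else true
  let c : ι → Bool := wellFounded_lt.fix step
  refine ⟨c, fun i => ?_⟩
  have h : ∃ j, s j = s i := ⟨i, rfl⟩
  have hc : h.choose = i := hs.injective h.choose_spec
  have : c (s i) = step (s i) (fun j _ => c j) := wellFounded_lt.fix_eq step (s i)
  rw [this]
  simp only [step, dif_pos h, hc]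

/-- Each summand kills one colour and sends the other colour into the killed one. -/
theorem exists_add_sq_zero_of_shift (f : Basis ι F V) {s : ι → ι} {c : ι → Bool}
    (hc : ∀ i, c (s i) = !c i) (d : F) {w : End F V} (hw : ∀ i, w (f i) = d • f (s i)) :
    ∃ a b : End F V, a ^ 2 = 0 ∧ b ^ 2 = 0 ∧ w = a + b := by
  refine ⟨f.constr F fun i => if c i then d • f (s i) else 0,
    f.constr F fun i => if c i then 0 else d • f (s i), f.ext fun i => ?_, f.ext fun i => ?_,
    f.ext fun i => ?_⟩ <;> cases h : c i <;> simp [pow_two, Basis.constr_basis, hc, h, hw]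

theorem exists_add_idempotent_of_shift (f : Basis ι F V) {s : ι → ι} {c : ι → Bool}
    (hc : ∀ i, c (s i) = !c i) (d : F) {w : End F V} (hw : ∀ i, w (f i) = f i + d • f (s i)) :
    ∃ p q : End F V, IsIdempotentElem p ∧ IsIdempotentElem q ∧ w = p + q := by
  refine ⟨f.constr F fun i => if c i then f i + d • f (s i) else 0,
    f.constr F fun i => if c i then 0 else f i + d • f (s i), f.ext fun i => ?_, f.ext fun i => ?_,
    f.ext fun i => ?_⟩ <;> cases h : c i <;> simp [Basis.constr_basis, hc, h, hw]

end Colouring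

/-! ### Unitriangular changes of basis. -/

section Triangular

variable {F V ι : Type*} [Field F] [AddCommGroup V] [Module F V] [LinearOrder ι]

theorem Module.Basis.repr_eq_zero_of_mem_span_Iio (e : Basis ι F V) {i : ι} {x : V}
    (hx : x ∈ Submodule.span F (e '' Set.Iio i)) {j : ι} (hij : i ≤ j) : e.repr x j = 0 := by
  by_contra h
  exact (not_lt.2 hij) ((e.mem_span_image.1 hx) (Finsupp.mem_support_iff.2 h))

theorem Module.Basis.exists_basis_of_unitriangular [WellFoundedLT ι] (e : Basis ι F V) (f : ι → V)
    (hf : ∀ i, f i - e i ∈ Submodule.span F (e '' Set.Iio i)) :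
    ∃ b : Basis ι F V, ∀ i, b i = f i := by
  have hli : LinearIndependent F f := by
    rw [linearIndependent_iff]
    intro l hl
    by_contra hne
    have hsupp : l.support.Nonempty := Finsupp.support_nonempty_iff.2 hne
    set m := l.support.max' hsupp
    have hm0 : l m ≠ 0 := Finsupp.mem_support_iff.1 (l.support.max'_mem hsupp)
    have key : e.repr (Finsupp.linearCombination F f l) m = l m := by
      rw [Finsupp.linearCombination_apply, Finsupp.sum, map_sum, Finsupp.finsetSum_apply,
        Finset.sum_eq_single m]
      · have := e.repr_eq_zero_of_mem_span_Iio (hf m) le_rfl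
        simp only [map_sub, Finsupp.sub_apply, Basis.repr_self, Finsupp.single_eq_same,
          sub_eq_zero] at this
        simp [this]
      · intro j hj hjm
        have hle : j ≤ m := l.support.le_max' j hj
        have := e.repr_eq_zero_of_mem_span_Iio (hf j) hle
        simp only [map_sub, Finsupp.sub_apply, Basis.repr_self,
          Finsupp.single_eq_of_ne (Ne.symm hjm), sub_zero] at this
        simp [this]
      · intro h
        exact absurd (l.support.max'_mem hsupp) h
    rw [hl] at key
    exact hm0 (by simpa using key.symm)
  have hmem : ∀ i, e i ∈ Submodule.span F (Set.range f) := by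
    intro i
    induction i using WellFoundedLT.induction with
    | ind i ih =>
      have h1 : f i - e i ∈ Submodule.span F (Set.range f) := by
        refine Submodule.span_le.2 ?_ (hf i)
        rintro _ ⟨j, hj, rfl⟩
        exact ih j hj
      have h2 : f i ∈ Submodule.span F (Set.range f) := Submodule.subset_span ⟨i, rfl⟩
      simpa using Submodule.sub_mem _ h2 h1
  have hsp : ⊤ ≤ Submodule.span F (Set.range f) := by
    rw [← e.span_eq]
    refine Submodule.span_le.2 ?_
    rintro _ ⟨i, rfl⟩
    exact hmem i
  exact ⟨Basis.mk hli hsp, fun i => Basis.mk_apply hli hsp i⟩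

/-- Keep `e i` off the range of `s` and propagate by `w` along `s`; monotonicity of `s` keeps the
new family unitriangular over `e`. -/
theorem Module.Basis.exists_basis_shift [WellFoundedLT ι] (e : Basis ι F V) {s : ι → ι}
    (hs : StrictMono s) (hlt : ∀ i, i < s i) {w : End F V}
    (hw : ∀ i, w (e i) - e (s i) ∈ Submodule.span F (e '' Set.Iio (s i))) :
    ∃ f : Basis ι F V, ∀ i, w (f i) = f (s i) := by
  classical
  let step : (i : ι) → ((j : ι) → j < i → V) → V := fun i IH =>
    if h : ∃ j, s j = i then w (IH h.choose ((hlt _).trans_eq h.choose_spec)) else e i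
  let f : ι → V := wellFounded_lt.fix step
  have hfix : ∀ i, f i = step i (fun j _ => f j) := wellFounded_lt.fix_eq step
  have hfs : ∀ i, f (s i) = w (f i) := by
    intro i
    have h : ∃ j, s j = s i := ⟨i, rfl⟩
    have hc : h.choose = i := hs.injective h.choose_spec
    rw [hfix (s i)]
    simp only [step, dif_pos h, hc]
  have hf : ∀ i, f i - e i ∈ Submodule.span F (e '' Set.Iio i) := by
    intro i
    induction i using WellFoundedLT.induction with
    | ind i ih =>
      by_cases h : ∃ j, s j = i
      · obtain ⟨j, rfl⟩ := h
        have h1 : w (f j - e j) ∈ Submodule.span F (e '' Set.Iio (s j)) := by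
          have hle : Submodule.span F (e '' Set.Iio j) ≤
              (Submodule.span F (e '' Set.Iio (s j))).comap w := by
            refine Submodule.span_le.2 ?_
            rintro _ ⟨k, hk, rfl⟩
            have hk' : s k < s j := hs hk
            have h2 := Submodule.span_mono (R := F)
              (Set.image_mono (f := e) (Set.Iio_subset_Iio hk'.le)) (hw k)
            have h3 : e (s k) ∈ Submodule.span F (e '' Set.Iio (s j)) :=
              Submodule.subset_span ⟨s k, hk', rfl⟩
            simpa using Submodule.add_mem _ h2 h3
          exact hle (ih j (hlt j))
        rw [hfs]
        have h2 := Submodule.add_mem _ h1 (hw j)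
        simpa using h2
      · have : f i = e i := by rw [hfix]; simp only [step, dif_neg h]
        simp [this]
  obtain ⟨b, hb⟩ := e.exists_basis_of_unitriangular f hf
  exact ⟨b, fun i => by rw [hb, hb, hfs]⟩

theorem exists_four_sums [WellFoundedLT ι] (e : Basis ι F V) {s : ι → ι}
    (hs : StrictMono s) (hlt : ∀ i, i < s i) {u : End F V}
    (hu : ∀ i, u (e i) ∈ Submodule.span F (e '' Set.Iio (s i))) :
    (∃ a : Fin 4 → End F V, (∀ k, a k ^ 2 = 0) ∧ u = ∑ k, a k) ∧
    (∃ p : Fin 4 → End F V, (∀ k, IsIdempotentElem (p k)) ∧ u = ∑ k, p k) := by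
  obtain ⟨c, hc⟩ := exists_two_colouring hs hlt
  let S : End F V := e.constr F fun i => e (s i)
  have hS : ∀ i, S (e i) = e (s i) := fun i => e.constr_basis F _ i
  constructor
  · obtain ⟨f, hf⟩ := e.exists_basis_shift hs hlt (w := u + S) fun i => by simpa [hS] using hu i
    obtain ⟨a, b, ha, hb, hab⟩ :=
      exists_add_sq_zero_of_shift e hc (-1) (w := -S) fun i => by simp [hS]
    obtain ⟨a', b', ha', hb', hab'⟩ :=
      exists_add_sq_zero_of_shift f hc 1 (w := u + S) fun i => by simpa using hf i
    refine ⟨![a, b, a', b'], fun k => by fin_cases k <;> assumption, ?_⟩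
    have : u = -S + (u + S) := by abel
    rw [this, hab, hab']
    simp [Fin.sum_univ_four, add_assoc]
  -- Subtracting `2` leaves the leading term alone, since `i < s i`.
  · obtain ⟨f, hf⟩ := e.exists_basis_shift hs hlt (w := u + S - 1 - 1) fun i => by
      have h1 : e i ∈ Submodule.span F (e '' Set.Iio (s i)) :=
        Submodule.subset_span ⟨i, hlt i, rfl⟩
      have h2 := Submodule.sub_mem _ (Submodule.sub_mem _ (hu i) h1) h1
      convert h2 using 1
      simp only [LinearMap.sub_apply, LinearMap.add_apply, hS, End.one_apply]
      abel
    obtain ⟨a, b, ha, hb, hab⟩ :=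
      exists_add_idempotent_of_shift e hc (-1) (w := 1 - S) fun i => by
        simp [hS, sub_eq_add_neg]
    obtain ⟨a', b', ha', hb', hab'⟩ :=
      exists_add_idempotent_of_shift f hc 1 (w := 1 + (u + S - 1 - 1)) fun i => by
        rw [LinearMap.add_apply, hf, one_smul, End.one_apply]
    refine ⟨![a, b, a', b'], fun k => by fin_cases k <;> assumption, ?_⟩
    have : u = (1 - S) + (1 + (u + S - 1 - 1)) := by abel
    rw [this, hab, hab']
    simp [Fin.sum_univ_four, add_assoc]

end Triangular

/-! ### Ordering a basis in countably infinite blocks. -/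

open Ordinal Cardinal

theorem Relation.ReflTransGen.countable_setOf {ι : Type*} {R : ι → ι → Prop}
    (hR : ∀ i, {j | R i j}.Countable) (i : ι) : {j | Relation.ReflTransGen R i j}.Countable := by
  let A : ℕ → Set ι := fun n => Nat.rec {i} (fun _ S => ⋃ k ∈ S, {j | R k j}) n
  have hA : ∀ n, (A n).Countable := by
    intro n
    induction n with
    | zero => exact Set.countable_singleton i
    | succ n ih => exact ih.biUnion fun k _ => hR k
  refine (Set.countable_iUnion hA).mono fun j hj => ?_
  induction hj with
  | refl => exact Set.mem_iUnion.2 ⟨0, rfl⟩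
  | tail _ hbc ih =>
    obtain ⟨n, hn⟩ := Set.mem_iUnion.1 ih
    exact Set.mem_iUnion.2 ⟨n + 1, Set.mem_biUnion hn hbc⟩

universe v

theorem Cardinal.mk_le_mk_range_of_countable_fibres {α β : Type v} [Uncountable α] {r : α → β}
    (hr : ∀ b, (r ⁻¹' {b}).Countable) : #α ≤ #(Set.range r) := by
  have h1 : #α ≤ #(Set.range r) * ℵ₀ := by
    have h2 := mk_iUnion_le (fun a : Set.range r => r ⁻¹' {a.1})
    have h3 : (⋃ a : Set.range r, r ⁻¹' {a.1}) = Set.univ :=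
      Set.eq_univ_of_forall fun i => Set.mem_iUnion.2 ⟨⟨r i, i, rfl⟩, rfl⟩
    rw [h3, mk_univ] at h2
    exact h2.trans (mul_le_mul' le_rfl (ciSup_le' fun a => (hr a.1).le_aleph0))
  by_contra! h
  exact absurd h1 (not_le.2 (mul_lt_of_lt aleph0_lt_mk.le h aleph0_lt_mk))

/-- The blocks of `r` are merged along the ordinal positions `ω * q + n` of their values, so
that every block becomes infinite. -/
theorem exists_rank_infinite_fibres {ι : Type v} [Uncountable ι] {R : ι → ι → Prop}
    (hR : ∀ i, {j | R i j}.Countable) :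
    ∃ f : ι → Ordinal.{v}, (∀ i j, R i j → f j ≤ f i) ∧
      ∀ i, (f ⁻¹' {f i}).Countable ∧ (f ⁻¹' {f i}).Infinite := by
  classical
  obtain ⟨_, _, hord⟩ := exists_ord_eq_type_lt ι
  have hne : ∀ i, {k | Relation.ReflTransGen R k i}.Nonempty := fun i => ⟨i, .refl⟩
  -- The least ancestor: it cannot increase along `R`, and its fibre over `a` lies among the
  -- countably many descendants of `a`.
  let r : ι → ι := fun i => wellFounded_lt.min {k | Relation.ReflTransGen R k i} (hne i)
  have hr : ∀ i, Relation.ReflTransGen R (r i) i := fun i => wellFounded_lt.min_mem _ (hne i)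
  have hmono : ∀ i j, R i j → r j ≤ r i := fun i j hij =>
    not_lt.1 (wellFounded_lt.not_lt_min {k | Relation.ReflTransGen R k j} ((hr i).tail hij))
  have hcount : ∀ a, (r ⁻¹' {a}).Countable := fun a =>
    (Relation.ReflTransGen.countable_setOf hR a).mono (by rintro i rfl; exact hr i)
  have hι : ℵ₀ < #ι := aleph0_lt_mk
  have hcard : #ι ≤ #(Set.range r) := mk_le_mk_range_of_countable_fibres hcount
  let pos : Set.range r → Ordinal.{v} := fun a => typein (α := Set.range r) (· < ·) a
  -- No final block is truncated: initial segments are smaller than `#ι`, and the range of `r` has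
  -- full cardinality.
  have hpos_lt : ∀ a (n : ℕ), pos a + n < type (α := Set.range r) (· < ·) := by
    intro a n
    have h1 : pos a < (#ι).ord := by
      rw [lt_ord, card_typein]
      refine lt_of_le_of_lt ?_ (card_typein_lt a.1 hord)
      rw [card_typein]
      exact mk_le_of_injective (f := fun b => ⟨b.1.1, b.2⟩) fun b c h => by
        simpa [Subtype.ext_iff] using h
    have h2 : pos a + n < (#ι).ord := by
      induction n with
      | zero => simpa using h1
      | succ n ih =>
        have := (isSuccLimit_ord hι.le).add_one_lt ih
        simpa [add_assoc] using this
    refine h2.trans_le ?_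
    rw [ord_le, card_type]
    exact hcard
  let p : ι → Ordinal.{v} := fun i => pos ⟨r i, i, rfl⟩
  have hp_inj : ∀ i j, p i = p j → r i = r j := fun i j h =>
    congrArg Subtype.val (typein_injective _ h)
  have hp_mono : ∀ i j, R i j → p j ≤ p i := fun i j hij =>
    (typein_le_typein _).2 (not_lt.2 (hmono i j hij))
  have hp_count : ∀ o, (p ⁻¹' {o}).Countable := by
    intro o
    by_cases h : ∃ i, p i = o
    · obtain ⟨i, rfl⟩ := h
      exact (hcount (r i)).mono fun j hj => hp_inj j i hj
    · convert Set.countable_empty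
      exact Set.eq_empty_of_forall_notMem fun i hi => h ⟨i, hi⟩
  refine ⟨fun i => p i / ω, fun i j hij => div_le_left (hp_mono i j hij) _, fun i => ⟨?_, ?_⟩⟩
  · refine (Set.countable_iUnion fun n : ℕ => hp_count (ω * (p i / ω) + n)).mono fun j hj => ?_
    obtain ⟨n, hn⟩ := lt_omega0.1 (mod_lt (p j) omega0_ne_zero)
    have hj' : p j / ω = p i / ω := hj
    refine Set.mem_iUnion.2 ⟨n, ?_⟩
    change p j = _
    rw [← hn, ← hj', div_add_mod]
  · have hex : ∀ n : ℕ, ∃ j, p j = ω * (p i / ω) + n := by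
      intro n
      have hlt : ω * (p i / ω) + n < type (α := Set.range r) (· < ·) := by
        refine lt_of_le_of_lt ?_ (hpos_lt ⟨r i, i, rfl⟩ n)
        exact add_le_add_left (mul_div_le (p i) ω) _
      obtain ⟨⟨_, j, rfl⟩, hj⟩ := typein_surj _ hlt
      exact ⟨j, hj⟩
    choose g hg using hex
    refine Set.infinite_of_injective_forall_mem (f := g) (fun m n hmn => ?_) fun n => ?_
    · have h := hg m
      rw [hmn, hg n] at h
      exact_mod_cast (add_left_cancel h).symm
    · change p (g n) / ω = p i / ω
      rw [hg, mul_add_div _ omega0_ne_zero, div_eq_zero_of_lt (natCast_lt_omega0 n), add_zero]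

theorem exists_equiv_prod_nat {ι : Type v} [Infinite ι] {R : ι → ι → Prop}
    (hR : ∀ i, {j | R i j}.Countable) :
    ∃ (O : Set Ordinal.{v}) (φ : ι ≃ O × ℕ), ∀ i j, R i j → (φ j).1 ≤ (φ i).1 := by
  obtain ⟨f, hf, hfib⟩ : ∃ f : ι → Ordinal.{v}, (∀ i j, R i j → f j ≤ f i) ∧
      ∀ i, (f ⁻¹' {f i}).Countable ∧ (f ⁻¹' {f i}).Infinite := by
    by_cases h : Countable ι
    · refine ⟨fun _ => 0, fun _ _ _ => le_rfl, fun i => ⟨Set.to_countable _, ?_⟩⟩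
      simpa using Set.infinite_univ
    · have : Uncountable ι := not_countable_iff.1 h
      exact exists_rank_infinite_fibres hR
  have hden : ∀ o : Set.range f, Nonempty ({i // Set.rangeFactorization f i = o} ≃ ℕ) := by
    rintro ⟨_, i, rfl⟩
    have hset : {j | Set.rangeFactorization f j = ⟨f i, i, rfl⟩} = f ⁻¹' {f i} := by
      ext j
      simp [Subtype.ext_iff]
    have h1 : Countable {j | Set.rangeFactorization f j = ⟨f i, i, rfl⟩} := by
      rw [hset]; exact (hfib i).1.to_subtype
    have h2 : Infinite {j | Set.rangeFactorization f j = ⟨f i, i, rfl⟩} := by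
      rw [hset]; exact (hfib i).2.to_subtype
    obtain ⟨h⟩ := nonempty_denumerable {j | Set.rangeFactorization f j = ⟨f i, i, rfl⟩}
    exact ⟨@Denumerable.eqv _ h⟩
  let ψ := fun o => (hden o).some
  exact ⟨Set.range f, (Equiv.sigmaFiberEquiv (Set.rangeFactorization f)).symm.trans
    ((Equiv.sigmaCongrRight ψ).trans (Equiv.sigmaEquivProd _ _)), hf⟩

theorem exists_strictMono_bound (t : ℕ → ℕ) :
    ∃ s : ℕ → ℕ, StrictMono s ∧ (∀ n, n < s n) ∧ ∀ n, t n < s n := by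
  let s : ℕ → ℕ := fun n => ∑ k ∈ Finset.range (n + 1), (t k + 1)
  have hs : StrictMono s := strictMono_nat_of_lt_succ fun n => by
    simp only [s]
    rw [Finset.sum_range_succ _ (n + 1)]
    omega
  refine ⟨s, hs, fun n => ?_, fun n => ?_⟩
  · have : s n = (∑ k ∈ Finset.range (n + 1), t k) + (n + 1) := by
      simp [s, Finset.sum_add_distrib]
    omega
  · simp only [s]
    rw [Finset.sum_range_succ]
    omega

theorem exists_basis_dominating_shift {F : Type*} [Field F] {V : Type v} [AddCommGroup V]
    [Module F V] (hV : ¬ FiniteDimensional F V) (u : End F V) :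
    ∃ (O : Set Ordinal.{v}) (e : Basis (O ×ₗ ℕ) F V) (s : O ×ₗ ℕ → O ×ₗ ℕ), StrictMono s ∧
      (∀ i, i < s i) ∧ ∀ i, u (e i) ∈ Submodule.span F (e '' Set.Iio (s i)) := by
  classical
  let b := Basis.ofVectorSpace F V
  have hinf : Infinite (Basis.ofVectorSpaceIndex F V) := by
    by_contra h
    rw [not_infinite_iff_finite] at h
    exact hV (Module.Finite.of_basis b)
  obtain ⟨O, φ, hφ⟩ := exists_equiv_prod_nat (R := fun i j => b.repr (u (b i)) j ≠ 0) fun i =>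
    (b.repr (u (b i))).hasFiniteSupport.countable
  let e : Basis (O ×ₗ ℕ) F V := b.reindex (φ.trans toLex)
  have hle : ∀ i j, e.repr (u (e i)) j ≠ 0 → (ofLex j).1 ≤ (ofLex i).1 := by
    intro i j h
    have := hφ (φ.symm (ofLex i)) (φ.symm (ofLex j)) (by
      simpa only [e, Basis.repr_reindex_apply, Basis.reindex_apply, Equiv.symm_trans_apply,
        toLex_symm_eq] using h)
    simpa using this
  -- Lower blocks are lexicographically smaller anyway, so only the finite support within the block
  -- needs bounding.
  choose s hs hlt hbd using fun o : O => exists_strictMono_bound fun n =>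
    (e.repr (u (e (toLex (o, n))))).support.sup fun j => (ofLex j).2
  refine ⟨O, e, fun i => toLex ((ofLex i).1, s (ofLex i).1 (ofLex i).2), ?_, ?_, ?_⟩
  · intro i j hij
    rw [Prod.Lex.lt_iff] at hij ⊢
    rcases hij with h | ⟨h, h'⟩
    · exact Or.inl h
    · refine Or.inr ⟨h, ?_⟩
      change s (ofLex i).1 _ < s (ofLex j).1 _
      rw [h]
      exact hs _ h'
  · intro i
    rw [Prod.Lex.lt_iff]
    exact Or.inr ⟨rfl, hlt _ _⟩
  · intro i
    rw [e.mem_span_image]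
    intro j hj
    rw [Set.mem_Iio, Prod.Lex.lt_iff]
    rcases (hle i j (Finsupp.mem_support_iff.1 hj)).lt_or_eq with h | h
    · exact Or.inl h
    · refine Or.inr ⟨h, lt_of_le_of_lt ?_ (hbd (ofLex i).1 (ofLex i).2)⟩
      exact Finset.le_sup (f := fun j : O ×ₗ ℕ => (ofLex j).2) hj

theorem corollary1 {F : Type*} [Field F] {V : Type*} [AddCommGroup V] [Module F V]
    (hV : ¬ FiniteDimensional F V) (u : Module.End F V) :
    (∃ a : Fin 4 → Module.End F V, (∀ k, a k ^ 2 = 0) ∧ u = ∑ k, a k) ∧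
    (∃ p : Fin 4 → Module.End F V, (∀ k, IsIdempotentElem (p k)) ∧ u = ∑ k, p k) := by
  obtain ⟨O, e, s, hs, hlt, hu⟩ := exists_basis_dominating_shift hV u
  exact exists_four_sums e hs hlt hu
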